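/- Let $q>1$ be real, let $[n]_q=1+q+\dots+q^{n-1}$, $[n]_q^!=[1]_q[2]_q\cdots[n]_q$ (with $[0]_q^!=1$), and let $\exp_q(z)=\sum_{n\ge0}z^n/[n]_q^!$. For a function $g$ holomorphic near $0$ let $$D_qg(z)=\frac{g(qz)-g(z)}{qz-z},\qquad D_{1,q}g(z)=\frac{g(z)-g(qz)}{z-qz}\qquad(z\ne0),\qquad D_qg(0)=D_{1,q}g(0)=g'(0),$$ be the Jackson $q$-derivative and the $(1,q)$-derivative, and let $\partial_{m_2,z}$ be the moment derivative for $m_2=([n]_q^!)_{n\ge0}$, i.e. the operator $\sum_{n\ge0} a_nz^n\mapsto\sum_{n\ge0}[n+1]_q\,a_{n+1}z^n$ on power series, applied to holomorphic functions through their Maclaurin series. Let $f$ be holomorphic on $D(0,r)$, $0<\varepsilon<r$, $k\in\mathbb{N}_0$ and $|z|<q^{-k}\varepsilon$. For $\theta\in\mathbb{R}$ put $L_\theta=[0,\infty)e^{i\theta}$. (i) For every $\omega$ with $|\omega|=\varepsilon$ and every $\theta\in\mathbb{R}$ with $\arg\omega+\theta\not\equiv\pi\pmod{2\pi}$, the integral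 $\int_{L_\theta}\zeta^k\frac{\exp_q(z\zeta)}{\exp_q(q\omega\zeta)}\,d\zeta$ converges absolutely. (ii) Let $\theta=\theta(\omega)$ be any choice of directions on the circle $|\omega|=\varepsilon$ such that $\arg\omega+\theta(\omega)\not\equiv\pi\pmod{2\pi}$ for all but at most countably many $\omega$ (for instance a constant $\theta$, for which exactly one $\omega$ is excluded). Then the outer integrand below is integrable over the circle, the power series $\partial_{m_2,z}^kf$ converges at $z$, and $$D_q^kf(z)=D_{1,q}^kf(z)=\partial_{m_2,z}^kf(z)=\frac{q-1}{2\pi i\log q}\oint_{|\omega|=\varepsilon}f(\omega)\int_{L_{\theta}}\zeta^k\frac{\exp_q(z\zeta)}{\exp_q(q\omega\zeta)}\,d\zeta\,d\omega .$$ -/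

import Mathlib

noncomputable section

/-- The `q`-number `[n]_q = 1 + q + ⋯ + q^(n-1)`. -/
def qNumber (q : ℝ) (n : ℕ) : ℝ := ∑ j ∈ Finset.range n, q ^ j

/-- The `q`-factorial `[n]_q^! = [1]_q [2]_q ⋯ [n]_q`. -/
def qFactorial (q : ℝ) (n : ℕ) : ℝ := ∏ j ∈ Finset.range n, qNumber q (j + 1)

/-- The `q`-exponential `exp_q(z) = ∑ z^n / [n]_q^!` (an entire function for `q > 1`). -/
def qExp (q : ℝ) (z : ℂ) : ℂ := ∑' n : ℕ, z ^ n / (qFactorial q n : ℂ)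

/-- Jackson's `q`-derivative, extended to the origin by its limit `f'(0)`. -/
def jacksonDeriv (q : ℝ) (f : ℂ → ℂ) (z : ℂ) : ℂ :=
  if z = 0 then deriv f 0 else (f (q * z) - f z) / (q * z - z)

/-- The `(p,q)`-derivative, extended to the origin by its limit `f'(0)`. -/
def pqDeriv (p q : ℝ) (f : ℂ → ℂ) (z : ℂ) : ℂ :=
  if z = 0 then deriv f 0 else (f (p * z) - f (q * z)) / (p * z - q * z)

/-- The formal moment derivative `∑ aₙ zⁿ ↦ ∑ (m(n+1)/m(n)) aₙ₊₁ zⁿ`. -/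
def momentDeriv (m : ℕ → ℝ) (a : PowerSeries ℂ) : PowerSeries ℂ :=
  PowerSeries.mk fun n => ((m (n + 1) / m n : ℝ) : ℂ) * PowerSeries.coeff (n + 1) a

/-- The Maclaurin series of `f`. -/
def maclaurin (f : ℂ → ℂ) : PowerSeries ℂ :=
  PowerSeries.mk fun n => iteratedDeriv n f 0 / (n.factorial : ℂ)

/-- `g` is absolutely integrable along the ray `L_θ = [0,∞) e^{iθ}`. -/
def RayIntegrable (θ : ℝ) (g : ℂ → ℂ) : Prop :=
  MeasureTheory.IntegrableOn
    (fun s : ℝ => g (s * Complex.exp (θ * Complex.I))) (Set.Ioi 0)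

/-- The integral of `g` along the ray `L_θ = [0,∞) e^{iθ}`, with `ζ = s e^{iθ}`. -/
def rayIntegral (θ : ℝ) (g : ℂ → ℂ) : ℂ :=
  ∫ s in Set.Ioi (0 : ℝ), g (s * Complex.exp (θ * Complex.I)) * Complex.exp (θ * Complex.I)

/-- The condition `arg ω + θ ≠ ±π`, modulo `2π`. -/
def Admissible (ω : ℂ) (θ : ℝ) : Prop :=
  ((Complex.arg ω + θ : ℝ) : Real.Angle) ≠ (Real.pi : Real.Angle)

/-- The kernel `ζ^k exp_q(zζ) / exp_q(qωζ)`. -/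
def qKernel (q : ℝ) (k : ℕ) (z ω ζ : ℂ) : ℂ :=
  ζ ^ k * (qExp q (z * ζ) / qExp q (q * ω * ζ))

/-- The double integral
`(q-1)/(2πi log q) ∮_{|ω|=ε} f(ω) ∫_{L_{θ(ω)}} ζ^k exp_q(zζ)/exp_q(qωζ) dζ dω`;
the direction of the ray is allowed to vary with `ω`. -/
def qCauchyIntegral (q : ℝ) (f : ℂ → ℂ) (ε : ℝ) (k : ℕ) (θ : ℂ → ℝ) (z : ℂ) : ℂ :=
  ((q - 1 : ℝ) : ℂ) / (2 * Real.pi * Complex.I * Real.log q) *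
    ∮ ω in C(0, ε), f ω * rayIntegral (θ ω) (qKernel q k z ω)

end

open Complex Filter MeasureTheory Set Topology

/-! Everything rests on exp_q(qz) = (1 + (q-1)z) exp_q(z) (`qExp_mul_left`). It confines the zeros
of exp_q to the negative real axis and forces power decay of the kernel
(`exists_norm_qKernel_le_rpow`). It also turns ∫ ds / exp_q(qws) into a Frullani integral and gives
a recursion for the higher moments, so that ∫ s^n / exp_q(qws) ds = (log q / (q-1)) [n]_q^! /
w^(n+1) (`integral_pow_div_qExp`).

Expanding exp_q(zζ) therefore makes the inner integral a series in z^n / ω^(n+k+1), the same for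
every admissible direction (`hasSum_rayIntegral_qKernel`). Integration against f over the circle
replaces ω^-(n+k+1) by the Taylor coefficient of index n+k. The resulting power series is that of
the k-th moment derivative, and D_q^k f has the same expansion because D_q z^(n+1) = [n+1]_q z^n. -/

/-! ### The q-factorial and the q-exponential -/

theorem le_qNumber {q : ℝ} (hq : 1 < q) (n : ℕ) : (n : ℝ) ≤ qNumber q n := by
  have h := Finset.card_nsmul_le_sum (Finset.range n) (fun j => q ^ j) 1
    fun j _ => one_le_pow₀ hq.le
  simpa [qNumber] using h

theorem qNumber_succ_pos {q : ℝ} (hq : 1 < q) (n : ℕ) : 0 < qNumber q (n + 1) :=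
  lt_of_lt_of_le (by positivity) (le_qNumber hq (n + 1))

theorem sub_one_mul_qNumber (q : ℝ) (n : ℕ) : (q - 1) * qNumber q n = q ^ n - 1 :=
  mul_geom_sum q n

theorem qFactorial_zero (q : ℝ) : qFactorial q 0 = 1 := by simp [qFactorial]

theorem qFactorial_succ (q : ℝ) (n : ℕ) :
    qFactorial q (n + 1) = qFactorial q n * qNumber q (n + 1) :=
  Finset.prod_range_succ _ _

theorem qFactorial_pos {q : ℝ} (hq : 1 < q) (n : ℕ) : 0 < qFactorial q n :=
  Finset.prod_pos fun j _ => qNumber_succ_pos hq j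

theorem factorial_le_qFactorial {q : ℝ} (hq : 1 < q) (n : ℕ) :
    (n.factorial : ℝ) ≤ qFactorial q n := by
  induction n with
  | zero => simp [qFactorial_zero]
  | succ n ih =>
    rw [qFactorial_succ, Nat.factorial_succ, mul_comm, Nat.cast_mul]
    exact mul_le_mul ih (le_qNumber hq (n + 1)) (by positivity) (qFactorial_pos hq n).le

theorem norm_qExp_term {q : ℝ} (hq : 1 < q) (n : ℕ) (z : ℂ) :
    ‖z ^ n / (qFactorial q n : ℂ)‖ = ‖z‖ ^ n / qFactorial q n := by
  rw [norm_div, norm_pow, norm_real, Real.norm_of_nonneg (qFactorial_pos hq n).le]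

theorem norm_qExp_term_le {q : ℝ} (hq : 1 < q) (n : ℕ) {z : ℂ} {R : ℝ} (hz : ‖z‖ ≤ R) :
    ‖z ^ n / (qFactorial q n : ℂ)‖ ≤ R ^ n / n.factorial := by
  rw [norm_qExp_term hq]
  have := factorial_le_qFactorial hq n
  have := (norm_nonneg z).trans hz
  gcongr

theorem hasSum_qExp {q : ℝ} (hq : 1 < q) (z : ℂ) :
    HasSum (fun n : ℕ => z ^ n / (qFactorial q n : ℂ)) (qExp q z) :=
  (Summable.of_norm_bounded (Real.summable_pow_div_factorial ‖z‖)
    fun n => norm_qExp_term_le hq n le_rfl).hasSum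

theorem continuous_qExp {q : ℝ} (hq : 1 < q) : Continuous (qExp q) := by
  rw [continuous_iff_continuousAt]
  intro z
  have h : ContinuousOn (qExp q) (Metric.closedBall 0 (‖z‖ + 1)) :=
    continuousOn_tsum (fun n => by fun_prop) (Real.summable_pow_div_factorial (‖z‖ + 1))
      fun n x hx => norm_qExp_term_le hq n (by simpa using hx)
  exact h.continuousAt (mem_of_superset (Metric.ball_mem_nhds z one_pos) fun x hx => by
    rw [Metric.mem_ball, dist_eq_norm] at hx
    have := norm_sub_norm_le x z
    simp only [mem_closedBall_zero_iff]
    linarith)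

theorem qExp_zero (q : ℝ) : qExp q 0 = 1 := by
  rw [qExp, tsum_eq_single 0 fun n hn => by simp [hn]]
  simp [qFactorial_zero]

/-- The `q`-difference equation of the `q`-exponential. -/
theorem qExp_mul_left {q : ℝ} (hq : 1 < q) (z : ℂ) :
    qExp q (q * z) = (1 + (q - 1) * z) * qExp q z := by
  have h1 := (hasSum_qExp hq (q * z)).sub (hasSum_qExp hq z)
  have h2 : HasSum (fun n : ℕ => (q * z) ^ n / (qFactorial q n : ℂ) - z ^ n / (qFactorial q n : ℂ))
      ((q - 1) * z * qExp q z) := by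
    -- The constant terms cancel; after the shift, (q-1)[n+1]_q = q^(n+1) - 1 lowers the factorial
    -- by one.
    rw [← hasSum_nat_add_iff' 1]
    simp only [Finset.range_one, Finset.sum_singleton, pow_zero, sub_self, sub_zero]
    refine ((hasSum_qExp hq z).mul_left ((q - 1) * z)).congr_fun fun n => ?_
    have e : ((q : ℂ) - 1) * qNumber q (n + 1) = q ^ (n + 1) - 1 := by
      exact_mod_cast congrArg (fun x : ℝ => (x : ℂ)) (sub_one_mul_qNumber q (n + 1))
    have a : (qFactorial q n : ℂ) ≠ 0 := mod_cast (qFactorial_pos hq n).ne'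
    have b : (qNumber q (n + 1) : ℂ) ≠ 0 := mod_cast (qNumber_succ_pos hq n).ne'
    rw [qFactorial_succ, ofReal_mul, mul_pow]
    field_simp
    linear_combination (-z ^ (n + 1)) * e
  linear_combination h1.unique h2

theorem one_add_mul_ne_zero_of_mem_slitPlane {w : ℂ} (hw : w ∈ slitPlane) {t : ℝ} (ht : 0 ≤ t) :
    1 + (t : ℂ) * w ≠ 0 := by
  intro h
  have hre := congrArg re h
  have him := congrArg im h
  simp at hre him
  rcases hw with hw | hw
  · nlinarith
  · rcases him with rfl | him
    · simp at hre
    · exact hw him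

/-- The zeros of the `q`-exponential lie on the negative real axis. -/
theorem qExp_ne_zero {q : ℝ} (hq : 1 < q) {w : ℂ} (hw : w ∈ slitPlane) {s : ℝ} (hs : 0 ≤ s) :
    qExp q (s * w) ≠ 0 := by
  have hq0 : 0 < q := one_pos.trans hq
  intro h
  -- A zero propagates inward along the ray, since the linear factor never vanishes there; the
  -- points tend to 0, where exp_q is 1.
  have hz : ∀ n : ℕ, qExp q (((q⁻¹ ^ n * s : ℝ) : ℂ) * w) = 0 := by
    intro n
    induction n with
    | zero => simpa using h
    | succ n ih =>
      have hf := qExp_mul_left hq (((q⁻¹ ^ (n + 1) * s : ℝ) : ℂ) * w)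
      have e : (q : ℂ) * (((q⁻¹ ^ (n + 1) * s : ℝ) : ℂ) * w) = ((q⁻¹ ^ n * s : ℝ) : ℂ) * w := by
        rw [← mul_assoc, ← ofReal_mul]
        congr 2
        rw [pow_succ]
        field_simp
      rw [e, ih, ← mul_assoc] at hf
      have hne := one_add_mul_ne_zero_of_mem_slitPlane hw
        (t := (q - 1) * (q⁻¹ ^ (n + 1) * s)) (mul_nonneg (by linarith) (by positivity))
      push_cast at hf hne ⊢
      exact (mul_eq_zero.mp hf.symm).resolve_left hne
  have hlim : Tendsto (fun n : ℕ => qExp q (((q⁻¹ ^ n * s : ℝ) : ℂ) * w)) atTop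
      (𝓝 (qExp q (((0 * s : ℝ) : ℂ) * w))) := by
    have h0 := tendsto_pow_atTop_nhds_zero_of_lt_one (inv_nonneg.mpr hq0.le)
      (inv_lt_one_of_one_lt₀ hq)
    have hc : Continuous fun x : ℝ => qExp q (((x * s : ℝ) : ℂ) * w) :=
      (continuous_qExp hq).comp (by fun_prop)
    exact (hc.tendsto 0).comp h0
  simp only [hz, zero_mul, ofReal_zero, qExp_zero] at hlim
  exact zero_ne_one (tendsto_nhds_unique tendsto_const_nhds hlim)

theorem qKernel_denominator_ne_zero {q : ℝ} (hq : 1 < q) {w : ℂ} (hw : w ∈ slitPlane) {s : ℝ}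
    (hs : 0 ≤ s) : qExp q (q * w * s) ≠ 0 := by
  have h := qExp_ne_zero hq hw (mul_nonneg (one_pos.trans hq).le hs)
  rwa [ofReal_mul, mul_right_comm] at h

/-! ### Decay and integrability of the kernel -/

theorem continuousOn_qKernel {q : ℝ} (hq : 1 < q) (k : ℕ) (z : ℂ) {w : ℂ} (hw : w ∈ slitPlane) :
    ContinuousOn (fun s : ℝ => qKernel q k z w s) (Ici 0) := by
  have hc := continuous_qExp hq
  refine ContinuousOn.mul (by fun_prop) (ContinuousOn.div ?_ ?_ fun s hs =>
    qKernel_denominator_ne_zero hq hw hs)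
  · exact (hc.comp (by fun_prop)).continuousOn
  · exact (hc.comp (by fun_prop)).continuousOn

theorem qKernel_mul_left {q : ℝ} (hq : 1 < q) (k : ℕ) (z w ζ : ℂ) :
    qKernel q k z w (q * ζ) =
      q ^ k * ((1 + (q - 1) * (z * ζ)) / (1 + (q - 1) * (q * w * ζ))) * qKernel q k z w ζ := by
  have e1 : z * (q * ζ) = q * (z * ζ) := by ring
  have e2 : q * w * (q * ζ) = q * (q * w * ζ) := by ring
  rw [qKernel, qKernel, e1, e2, qExp_mul_left hq, qExp_mul_left hq, mul_pow, mul_div_mul_comm]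
  ring

/-- Each s ≥ S is q^n t with t in the fundamental interval [S, qS], so a bound there propagates. -/
theorem le_of_comp_mul_le {q S C : ℝ} (hq : 1 < q) (hS : 0 < S) {g : ℝ → ℝ}
    (hg : ∀ s, S ≤ s → g (q * s) ≤ g s) (hC : ∀ s ∈ Icc S (q * S), g s ≤ C) {s : ℝ} (hs : S ≤ s) :
    g s ≤ C := by
  have hq0 : 0 < q := one_pos.trans hq
  have hiter : ∀ (n : ℕ) (t : ℝ), S ≤ t → g (q ^ n * t) ≤ g t := by
    intro n
    induction n with
    | zero => intro t _; simp
    | succ n ih =>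
      intro t ht
      have h1 : S ≤ q ^ n * t :=
        ht.trans (le_mul_of_one_le_left (hS.le.trans ht) (one_le_pow₀ hq.le))
      calc g (q ^ (n + 1) * t) = g (q * (q ^ n * t)) := by rw [pow_succ]; ring_nf
        _ ≤ g (q ^ n * t) := hg _ h1
        _ ≤ g t := ih t ht
  obtain ⟨n, hn1, hn2⟩ := exists_nat_pow_near ((one_le_div hS).mpr hs) hq
  have hqn : 0 < q ^ n := pow_pos hq0 n
  have h1 : S ≤ s / q ^ n := by
    rw [le_div_iff₀ hS] at hn1
    rw [le_div_iff₀ hqn]; linarith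
  have h2 : s / q ^ n ≤ q * S := by
    rw [div_lt_iff₀ hS, pow_succ] at hn2
    rw [div_le_iff₀ hqn]; nlinarith
  have h3 := hiter n _ h1
  rw [mul_div_cancel₀ _ hqn.ne'] at h3
  exact h3.trans (hC _ ⟨h1, h2⟩)

/-- Under s ↦ qs the kernel gains a factor whose norm tends to q^(k-1)‖z‖/‖w‖. Taking c = q^δ makes
the left-hand constant q^(δ+1), which matches decay like s^-(δ+1). -/
theorem eventually_qKernel_ratio_le {q : ℝ} (hq : 1 < q) (k : ℕ) {z w : ℂ} {c : ℝ} (hc : 0 < c)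
    (h : c * (q ^ k * ‖z‖) < ‖w‖) :
    ∀ᶠ s : ℝ in atTop, c * q * ‖qKernel q k z w ((q * s : ℝ) : ℂ)‖ ≤ ‖qKernel q k z w s‖ := by
  have hq0 : 0 < q := one_pos.trans hq
  have hlin : Tendsto (fun s : ℝ => (q - 1) * q * (‖w‖ - c * (q ^ k * ‖z‖)) * s) atTop atTop :=
    tendsto_id.const_mul_atTop (mul_pos (mul_pos (by linarith) hq0) (by linarith))
  filter_upwards [hlin.eventually_ge_atTop (c * q * q ^ k + 1), eventually_gt_atTop 0] with s hs hs0
  have hz : ‖1 + ((q : ℂ) - 1) * (z * s)‖ ≤ 1 + (q - 1) * (‖z‖ * s) := by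
    refine (norm_add_le _ _).trans ?_
    rw [norm_one, norm_mul, norm_mul, norm_real, Real.norm_of_nonneg hs0.le]
    rw [← ofReal_one, ← ofReal_sub, norm_real, Real.norm_of_nonneg (by linarith)]
  have hw : (q - 1) * (q * ‖w‖ * s) - 1 ≤ ‖1 + ((q : ℂ) - 1) * (q * w * s)‖ := by
    have h1 := norm_sub_norm_le (((q : ℂ) - 1) * (q * w * s)) (-1)
    rw [norm_neg, norm_one, sub_neg_eq_add, add_comm (_ * _) (1 : ℂ), norm_mul, norm_mul, norm_mul,
      norm_real, norm_real, Real.norm_of_nonneg hs0.le, Real.norm_of_nonneg hq0.le,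
      ← ofReal_one, ← ofReal_sub, norm_real, Real.norm_of_nonneg (by linarith)] at h1
    simpa using h1
  have hpos : 0 < ‖1 + ((q : ℂ) - 1) * (q * w * s)‖ := by
    have h2 : 0 ≤ (q - 1) * q * (c * (q ^ k * ‖z‖)) * s := by
      have : 0 ≤ q - 1 := by linarith
      positivity
    have h3 : 0 < c * q * q ^ k := by positivity
    linarith
  have hle : c * q * q ^ k * ‖1 + ((q : ℂ) - 1) * (z * s)‖ ≤ ‖1 + ((q : ℂ) - 1) * (q * w * s)‖ := by
    have h3 : 0 ≤ c * q * q ^ k := by positivity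
    have := mul_le_mul_of_nonneg_left hz h3
    linarith
  rw [ofReal_mul, qKernel_mul_left hq, norm_mul, norm_mul, norm_div, norm_pow, norm_real,
    Real.norm_of_nonneg hq0.le, ← mul_assoc]
  refine mul_le_of_le_one_left (norm_nonneg _) ?_
  rw [← mul_assoc, ← mul_div_assoc, div_le_one hpos]
  exact hle

/-- Power decay of the kernel along a ray that avoids the zeros of the denominator. -/
theorem exists_norm_qKernel_le_rpow {q : ℝ} (hq : 1 < q) (k : ℕ) {z w : ℂ} (hw : w ∈ slitPlane)
    (hzw : q ^ k * ‖z‖ < ‖w‖) :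
    ∃ a < (-1 : ℝ), ∃ S > 0, ∃ C : ℝ, ∀ s : ℝ, S ≤ s → ‖qKernel q k z w s‖ ≤ C * s ^ a := by
  have hq0 : 0 < q := one_pos.trans hq
  -- The strict inequality leaves room for a factor q^δ, which pushes the decay exponent below -1.
  obtain ⟨δ, hδ, hδ'⟩ : ∃ δ > (0 : ℝ), q ^ δ * (q ^ k * ‖z‖) < ‖w‖ := by
    have hcont : ContinuousAt (fun δ : ℝ => q ^ δ * (q ^ k * ‖z‖)) 0 :=
      (Real.continuousAt_const_rpow hq0.ne').mul continuousAt_const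
    have hev := hcont.eventually_lt (continuousAt_const (y := ‖w‖)) (by simpa using hzw)
    obtain ⟨δ, h1, h2⟩ := ((hev.filter_mono nhdsWithin_le_nhds).and
      (self_mem_nhdsWithin (s := Ioi (0 : ℝ)))).exists
    exact ⟨δ, h2, h1⟩
  obtain ⟨S₀, hS₀⟩ := eventually_atTop.mp
    (eventually_qKernel_ratio_le hq k (Real.rpow_pos_of_pos hq0 δ) hδ')
  set S := max S₀ 1
  have hS : 0 < S := lt_of_lt_of_le one_pos (le_max_right _ _)
  have hcont : ContinuousOn (fun s : ℝ => s ^ (δ + 1) * ‖qKernel q k z w s‖) (Icc S (q * S)) := by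
    have hsub : Icc S (q * S) ⊆ Ici 0 := fun s hs => hS.le.trans hs.1
    exact (ContinuousOn.rpow_const continuousOn_id fun s _ => Or.inr (by linarith)).mul
      ((continuousOn_qKernel hq k z hw).mono hsub).norm
  obtain ⟨C, hC⟩ := isCompact_Icc.bddAbove_image hcont
  refine ⟨-(δ + 1), by linarith, S, hS, C, fun s hs => ?_⟩
  have hs0 : 0 < s := hS.trans_le hs
  have hb := le_of_comp_mul_le hq hS (g := fun s : ℝ => s ^ (δ + 1) * ‖qKernel q k z w s‖)
    (fun t ht => ?_) (fun t ht => hC (mem_image_of_mem _ ht)) hs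
  · rw [Real.rpow_neg hs0.le, ← div_eq_mul_inv, le_div_iff₀ (Real.rpow_pos_of_pos hs0 _), mul_comm]
    exact hb
  · have ht0 : 0 < t := hS.trans_le ht
    have h1 := hS₀ t ((le_max_left _ _).trans ht)
    rw [Real.mul_rpow hq0.le ht0.le, Real.rpow_add hq0, Real.rpow_one,
      mul_comm (q ^ δ * q), mul_assoc]
    exact mul_le_mul_of_nonneg_left h1 (Real.rpow_nonneg ht0.le _)

theorem integrableOn_qKernel {q : ℝ} (hq : 1 < q) (k : ℕ) {z w : ℂ} (hw : w ∈ slitPlane)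
    (hzw : q ^ k * ‖z‖ < ‖w‖) :
    IntegrableOn (fun s : ℝ => qKernel q k z w s) (Ioi 0) := by
  obtain ⟨a, ha, S, hS, C, hC⟩ := exists_norm_qKernel_le_rpow hq k hw hzw
  have hcont := continuousOn_qKernel hq k z hw
  rw [← Ioc_union_Ioi_eq_Ioi hS.le]
  refine IntegrableOn.union ?_ ?_
  · exact ((hcont.mono Icc_subset_Ici_self).integrableOn_Icc).mono_set Ioc_subset_Icc_self
  · refine Integrable.mono' ((integrableOn_Ioi_rpow_of_lt ha hS).const_mul C) ?_ ?_
    · exact (hcont.mono fun s hs => hS.le.trans (le_of_lt hs)).aestronglyMeasurable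
        measurableSet_Ioi
    · exact (ae_restrict_iff' measurableSet_Ioi).mpr (ae_of_all _ fun s hs => hC s (le_of_lt hs))

theorem tendsto_qKernel_atTop {q : ℝ} (hq : 1 < q) (k : ℕ) {z w : ℂ} (hw : w ∈ slitPlane)
    (hzw : q ^ k * ‖z‖ < ‖w‖) :
    Tendsto (fun s : ℝ => qKernel q k z w s) atTop (𝓝 0) := by
  obtain ⟨a, ha, S, hS, C, hC⟩ := exists_norm_qKernel_le_rpow hq k hw hzw
  have h0 : Tendsto (fun s : ℝ => C * s ^ a) atTop (𝓝 (C * 0)) := by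
    have := (tendsto_rpow_neg_atTop (y := -a) (by linarith)).const_mul C
    simpa using this
  rw [mul_zero] at h0
  exact squeeze_zero_norm' ((eventually_ge_atTop S).mono hC) h0

/-! ### Moments of the reciprocal q-exponential -/

theorem qKernel_zero_right (q : ℝ) (k : ℕ) (w ζ : ℂ) :
    qKernel q k 0 w ζ = ζ ^ k / qExp q (q * w * ζ) := by
  rw [qKernel, zero_mul, qExp_zero, ← mul_div_assoc, mul_one]

theorem integrableOn_pow_div_qExp {q : ℝ} (hq : 1 < q) (n : ℕ) {w : ℂ} (hw : w ∈ slitPlane) :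
    IntegrableOn (fun s : ℝ => (s : ℂ) ^ n / qExp q (q * w * s)) (Ioi 0) := by
  have h := integrableOn_qKernel hq n (z := 0) hw
    (by simpa using slitPlane_ne_zero hw)
  simpa only [qKernel_zero_right] using h

theorem inv_qExp_eq {q : ℝ} (hq : 1 < q) {w : ℂ} (hw : w ∈ slitPlane) {s : ℝ} (hs : 0 ≤ s) :
    (qExp q (w * s))⁻¹ = (1 + (q - 1) * (w * s)) / qExp q (q * w * s) := by
  have h := qExp_mul_left hq (w * s)
  have h1 := qExp_ne_zero hq hw hs
  have h2 := qKernel_denominator_ne_zero hq hw hs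
  rw [mul_comm] at h1
  rw [eq_div_iff h2, inv_mul_eq_iff_eq_mul₀ h1, mul_assoc, h, mul_comm]

/-- With h(s) = 1/exp_q(ws), the difference equation gives (h(s) - h(qs))/s = (q-1)w / exp_q(qws).
Frullani's formula applies with h(0) = 1 and h(∞) = 0. -/
theorem integral_inv_qExp {q : ℝ} (hq : 1 < q) {w : ℂ} (hw : w ∈ slitPlane) :
    ∫ s : ℝ in Ioi 0, (s : ℂ) ^ 0 / qExp q (q * w * s) = Real.log q / ((q - 1) * w) := by
  have hq0 : 0 < q := one_pos.trans hq
  have hw0 := slitPlane_ne_zero hw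
  have hq1 : (q : ℂ) - 1 ≠ 0 := by
    rw [sub_ne_zero]; exact_mod_cast hq.ne'
  have hcont : ContinuousOn (fun s : ℝ => (qExp q (w * s))⁻¹) (Ici 0) :=
    ContinuousOn.inv₀ ((continuous_qExp hq).comp (by fun_prop)).continuousOn fun s hs => by
      rw [mul_comm]; exact qExp_ne_zero hq hw hs
  have hpt : ∀ s ∈ Ioi (0 : ℝ), s⁻¹ • ((qExp q (w * ((1 * s : ℝ) : ℂ)))⁻¹ -
      (qExp q (w * ((q * s : ℝ) : ℂ)))⁻¹) = (q - 1) * w * ((s : ℂ) ^ 0 / qExp q (q * w * s)) := by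
    intro s hs
    have hs0 : (s : ℂ) ≠ 0 := mod_cast (ne_of_gt hs)
    have h2 := qKernel_denominator_ne_zero hq hw (le_of_lt hs)
    have e : w * ((q * s : ℝ) : ℂ) = q * w * s := by push_cast; ring
    rw [one_mul, e, inv_qExp_eq hq hw (le_of_lt hs), real_smul, ofReal_inv]
    field_simp
    ring
  have hL : Tendsto (fun s : ℝ => (qExp q (w * s))⁻¹) (𝓝[>] 0) (𝓝 1) := by
    have h := (hcont 0 self_mem_Ici).mono Ioi_subset_Ici_self
    simpa [ContinuousWithinAt, qExp_zero] using h
  have hR : Tendsto (fun s : ℝ => (qExp q (w * s))⁻¹) atTop (𝓝 0) := by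
    have h := (tendsto_qKernel_atTop hq 0 (z := 0) hw (by simpa using hw0)).comp
      (tendsto_id.const_mul_atTop (inv_pos.mpr hq0))
    refine h.congr fun s => ?_
    have e : q * w * ((q⁻¹ * s : ℝ) : ℂ) = w * s := by
      have : (q : ℂ) ≠ 0 := mod_cast hq0.ne'
      push_cast; field_simp
    simp only [Function.comp_apply, id, qKernel_zero_right, e, pow_zero, one_div]
  have hint : IntegrableOn (fun s : ℝ => s⁻¹ • ((qExp q (w * ((1 * s : ℝ) : ℂ)))⁻¹ -
      (qExp q (w * ((q * s : ℝ) : ℂ)))⁻¹)) (Ioi 0) :=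
    IntegrableOn.congr_fun ((integrableOn_pow_div_qExp hq 0 hw).const_mul ((q - 1) * w))
      (fun s hs => (hpt s hs).symm) measurableSet_Ioi
  have h := Frullani.integral_Ioi_eq (f := fun s : ℝ => (qExp q (w * s))⁻¹)
    ((hcont.mono Ioi_subset_Ici_self).locallyIntegrableOn measurableSet_Ioi)
    one_pos hq0 hL hR hint
  rw [setIntegral_congr_fun measurableSet_Ioi hpt, integral_const_mul] at h
  rw [eq_div_iff (mul_ne_zero hq1 hw0), mul_comm, h]
  simp

/-- The moments of `1 / exp_q(q w s)` along the half-line are `q`-factorials. -/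
theorem integral_pow_div_qExp {q : ℝ} (hq : 1 < q) {w : ℂ} (hw : w ∈ slitPlane) (n : ℕ) :
    ∫ s : ℝ in Ioi 0, (s : ℂ) ^ n / qExp q (q * w * s) =
      Real.log q / (q - 1) * qFactorial q n / w ^ (n + 1) := by
  have hq0 : 0 < q := one_pos.trans hq
  have hqc : (q : ℂ) ≠ 0 := mod_cast hq0.ne'
  have hw0 := slitPlane_ne_zero hw
  have hq1 : (q : ℂ) - 1 ≠ 0 := by
    rw [sub_ne_zero]; exact_mod_cast hq.ne'
  induction n with
  | zero =>
    rw [integral_inv_qExp hq hw, qFactorial_zero]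
    field_simp
    simp
  | succ n ih =>
    -- Rescaling by q and then expanding 1/exp_q(ws) gives q^(n+1) M_n = M_n + (q-1) w M_(n+1) for
    -- the moments M_n.
    have hscale := integral_comp_mul_left_Ioi (fun s : ℝ => (s : ℂ) ^ n / qExp q (w * s)) 0 hq0
    have hl : ∀ s : ℝ, ((q * s : ℝ) : ℂ) ^ n / qExp q (w * ((q * s : ℝ) : ℂ)) =
        q ^ n * ((s : ℂ) ^ n / qExp q (q * w * s)) := by
      intro s
      have e : w * ((q * s : ℝ) : ℂ) = q * w * s := by push_cast; ring
      rw [e, ofReal_mul, mul_pow, mul_div_assoc]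
    have hr : ∀ s ∈ Ioi (0 : ℝ), (s : ℂ) ^ n / qExp q (w * s) =
        (s : ℂ) ^ n / qExp q (q * w * s) +
          (q - 1) * w * ((s : ℂ) ^ (n + 1) / qExp q (q * w * s)) := by
      intro s hs
      rw [div_eq_mul_inv, inv_qExp_eq hq hw (le_of_lt hs)]
      ring
    simp only [hl] at hscale
    rw [mul_zero, integral_const_mul, setIntegral_congr_fun measurableSet_Ioi hr,
      integral_add (integrableOn_pow_div_qExp hq n hw)
        ((integrableOn_pow_div_qExp hq (n + 1) hw).const_mul _), integral_const_mul, ih,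
      real_smul, ofReal_inv] at hscale
    have e : ((q : ℂ) - 1) * qNumber q (n + 1) = q ^ (n + 1) - 1 := by
      exact_mod_cast congrArg (fun x : ℝ => (x : ℂ)) (sub_one_mul_qNumber q (n + 1))
    rw [eq_inv_mul_iff_mul_eq₀ hqc] at hscale
    rw [qFactorial_succ, ofReal_mul, ← mul_right_inj' (mul_ne_zero hq1 hw0)]
    have hgoal : ((q : ℂ) - 1) * w * (Real.log q / (q - 1) *
        (qFactorial q n * qNumber q (n + 1)) / w ^ (n + 1 + 1)) =
        (((q : ℂ) - 1) * qNumber q (n + 1)) *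
          (Real.log q / (q - 1) * qFactorial q n / w ^ (n + 1)) := by
      rw [pow_succ w (n + 1)]
      field_simp
    rw [hgoal, e]
    linear_combination -hscale

/-! ### Series for the inner integral -/

theorem hasSum_norm_qExp {q : ℝ} (hq : 1 < q) (z : ℂ) :
    HasSum (fun n : ℕ => ‖z ^ n / (qFactorial q n : ℂ)‖) ‖qExp q (‖z‖ : ℂ)‖ := by
  have hs : Summable fun n : ℕ => ‖z ^ n / (qFactorial q n : ℂ)‖ := (hasSum_qExp hq z).summable.norm
  have h : qExp q (‖z‖ : ℂ) = ((∑' n : ℕ, ‖z ^ n / (qFactorial q n : ℂ)‖ : ℝ) : ℂ) := by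
    refine (hasSum_qExp hq (‖z‖ : ℂ)).unique ?_
    refine HasSum.congr_fun (hasSum_ofReal.mpr hs.hasSum) fun n => Eq.symm ?_
    rw [norm_qExp_term hq]
    push_cast
    rfl
  rw [h, norm_real, Real.norm_of_nonneg (tsum_nonneg fun n => norm_nonneg _)]
  exact hs.hasSum

/-- Termwise integration of the kernel along the half-line. -/
theorem hasSum_integral_qKernel {q : ℝ} (hq : 1 < q) (k : ℕ) {z w : ℂ} (hw : w ∈ slitPlane)
    (hzw : q ^ k * ‖z‖ < ‖w‖) :
    HasSum (fun n : ℕ => z ^ n / qFactorial q n *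
        (Real.log q / (q - 1) * qFactorial q (n + k) / w ^ (n + k + 1)))
      (∫ s : ℝ in Ioi 0, qKernel q k z w s) := by
  have hsplit : ∀ (n : ℕ) (s : ℝ),
      z ^ n / qFactorial q n * ((s : ℂ) ^ (n + k) / qExp q (q * w * s)) =
      (z * s) ^ n / qFactorial q n * ((s : ℂ) ^ k / qExp q (q * w * s)) := fun n s => by ring
  -- The norms of the terms sum to the norm of the kernel at ‖z‖, which satisfies the same smallness
  -- hypothesis; this provides the integrable majorant.
  have hnorm : ∀ s ∈ Ioi (0 : ℝ), HasSum (fun n : ℕ =>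
      ‖z ^ n / qFactorial q n * ((s : ℂ) ^ (n + k) / qExp q (q * w * s))‖)
      ‖qKernel q k (‖z‖ : ℂ) w s‖ := by
    intro s hs
    have h := (hasSum_norm_qExp hq (z * s)).mul_right ‖(s : ℂ) ^ k / qExp q (q * w * s)‖
    simp only [← norm_mul, ← hsplit] at h
    have e : qKernel q k (‖z‖ : ℂ) w s =
        qExp q (‖z * s‖ : ℂ) * ((s : ℂ) ^ k / qExp q (q * w * s)) := by
      rw [norm_mul z, norm_real, Real.norm_of_nonneg (le_of_lt hs), ofReal_mul, qKernel]
      ring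
    rwa [e]
  have h := hasSum_integral_of_dominated_convergence (μ := volume.restrict (Ioi (0 : ℝ)))
    (F := fun (n : ℕ) (s : ℝ) =>
      z ^ n / qFactorial q n * ((s : ℂ) ^ (n + k) / qExp q (q * w * s)))
    (f := fun s : ℝ => qKernel q k z w s)
    (fun n s => ‖z ^ n / qFactorial q n * ((s : ℂ) ^ (n + k) / qExp q (q * w * s))‖)
    (fun n => ((integrableOn_pow_div_qExp hq (n + k) hw).const_mul _).aestronglyMeasurable)
    (fun n => ae_of_all _ fun s => le_rfl)
    ((ae_restrict_iff' measurableSet_Ioi).mpr (ae_of_all _ fun s hs => (hnorm s hs).summable))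
    ((integrableOn_qKernel hq k (z := (‖z‖ : ℂ)) hw (by simpa using hzw)).norm.congr
      ((ae_restrict_iff' measurableSet_Ioi).mpr
        (ae_of_all _ fun s hs => (hnorm s hs).tsum_eq.symm)))
    (ae_of_all _ fun s => ?_)
  · simpa only [integral_const_mul, integral_pow_div_qExp hq hw] using h
  · have h1 := (hasSum_qExp hq (z * s)).mul_right ((s : ℂ) ^ k / qExp q (q * w * s))
    simp only [← hsplit] at h1
    have e : qKernel q k z w s = qExp q (z * s) * ((s : ℂ) ^ k / qExp q (q * w * s)) := by
      rw [qKernel]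
      ring
    rwa [e]

theorem mul_exp_mem_slitPlane {ω : ℂ} (hω : ω ≠ 0) {θ : ℝ} (h : Admissible ω θ) :
    ω * exp (θ * I) ∈ slitPlane := by
  rw [mem_slitPlane_iff_arg]
  refine ⟨fun harg => h ?_, mul_ne_zero hω (exp_ne_zero _)⟩
  rw [← harg, arg_mul_coe_angle hω (exp_ne_zero _), Real.Angle.coe_add, arg_exp_mul_I,
    Real.Angle.coe_toIocMod]

/-- Absorbs the direction of a ray into z and ω without changing their norms when u is unimodular,
reducing every ray to the positive half-line. -/
theorem qKernel_mul_right (q : ℝ) (k : ℕ) (z ω ζ u : ℂ) :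
    qKernel q k z ω (ζ * u) = u ^ k * qKernel q k (z * u) (ω * u) ζ := by
  have e1 : z * (ζ * u) = z * u * ζ := by ring
  have e2 : q * ω * (ζ * u) = q * (ω * u) * ζ := by ring
  rw [qKernel, qKernel, e1, e2]
  ring

theorem rayIntegrable_qKernel {q : ℝ} (hq : 1 < q) (k : ℕ) {z ω : ℂ} (hzω : q ^ k * ‖z‖ < ‖ω‖)
    {θ : ℝ} (h : Admissible ω θ) : RayIntegrable θ (qKernel q k z ω) := by
  have hq0 : 0 < q := one_pos.trans hq
  have hω : ω ≠ 0 := norm_pos_iff.mp (lt_of_le_of_lt (by positivity) hzω)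
  simp only [RayIntegrable, qKernel_mul_right]
  exact (integrableOn_qKernel hq k (mul_exp_mem_slitPlane hω h)
    (by simpa [norm_exp_ofReal_mul_I] using hzω)).const_mul _

/-- The value of the inner integral does not depend on the admissible direction. -/
theorem hasSum_rayIntegral_qKernel {q : ℝ} (hq : 1 < q) (k : ℕ) {z ω : ℂ}
    (hzω : q ^ k * ‖z‖ < ‖ω‖) {θ : ℝ} (h : Admissible ω θ) :
    HasSum (fun n : ℕ => Real.log q / (q - 1) * (qFactorial q (n + k) / qFactorial q n) *
      (z ^ n / ω ^ (n + k + 1))) (rayIntegral θ (qKernel q k z ω)) := by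
  have hq0 : 0 < q := one_pos.trans hq
  have hω : ω ≠ 0 := norm_pos_iff.mp (lt_of_le_of_lt (by positivity) hzω)
  have hu := exp_ne_zero (θ * I)
  -- The factor u^(k+1), from ζ^k dζ with u = e^(iθ), cancels u^n / u^(n+k+1); hence no dependence
  -- on θ remains.
  have hs := (hasSum_integral_qKernel hq k (z := z * exp (θ * I)) (mul_exp_mem_slitPlane hω h)
    (by simpa [norm_exp_ofReal_mul_I] using hzω)).mul_left (exp (θ * I) ^ (k + 1))
  simp only [rayIntegral, qKernel_mul_right]
  rw [integral_mul_const, integral_const_mul, mul_right_comm, ← pow_succ]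
  refine HasSum.congr_fun hs fun n => Eq.symm ?_
  have hp : exp (θ * I) ^ (n + k + 1) = exp (θ * I) ^ n * exp (θ * I) ^ (k + 1) := by
    rw [← pow_add, add_assoc]
  rw [mul_pow, mul_pow, hp]
  have h1 := pow_ne_zero n hu
  have h2 := pow_ne_zero (k + 1) hu
  generalize exp (θ * I) ^ n = A at *
  generalize exp (θ * I) ^ (k + 1) = B at *
  field_simp

/-- No ratio test is needed: up to a nonzero constant this is the inner series at z = x, ω = ε, θ =
0, already known to converge. -/
theorem summable_qFactorial_ratio {q : ℝ} (hq : 1 < q) (k : ℕ) {x ε : ℝ} (hx : 0 ≤ x)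
    (h : q ^ k * x < ε) :
    Summable fun n : ℕ => qFactorial q (n + k) / qFactorial q n * (x ^ n / ε ^ (n + k + 1)) := by
  have hq0 : 0 < q := one_pos.trans hq
  have hε : 0 < ε := lt_of_le_of_lt (by positivity) h
  have hadm : Admissible (ε : ℂ) 0 := by
    simp only [Admissible, arg_ofReal_of_nonneg hε.le, add_zero, Real.Angle.coe_zero]
    exact Real.Angle.pi_ne_zero.symm
  have hs := (hasSum_rayIntegral_qKernel hq k (z := (x : ℂ)) (ω := (ε : ℂ))
    (by simpa [abs_of_nonneg hx, abs_of_pos hε] using h) hadm).summable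
  simp only [mul_assoc] at hs
  have hL : (Real.log q : ℂ) / ((q : ℂ) - 1) ≠ 0 := by
    refine div_ne_zero (mod_cast (Real.log_pos hq).ne') ?_
    rw [sub_ne_zero]; exact_mod_cast hq.ne'
  rw [summable_mul_left_iff hL] at hs
  rw [← summable_ofReal]
  exact_mod_cast hs

/-! ### Integration over the circle -/

theorem circleIntegral_div_pow {r ε : ℝ} {f : ℂ → ℂ}
    (hf : DifferentiableOn ℂ f (Metric.ball 0 r)) (hε : 0 < ε) (hεr : ε < r) (n : ℕ) :
    ∮ ω in C(0, ε), f ω / ω ^ (n + 1) =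
      2 * Real.pi * I * (iteratedDeriv n f 0 / (n.factorial : ℂ)) := by
  have h := circleIntegral_one_div_sub_center_pow_smul_of_differentiable_on_off_countable
    (c := 0) hε n countable_empty
    (hf.continuousOn.mono (Metric.closedBall_subset_ball hεr))
    (fun z hz => hf.differentiableAt
      (Metric.isOpen_ball.mem_nhds (Metric.ball_subset_ball hεr.le hz.1)))
  simp only [sub_zero, smul_eq_mul, one_div] at h
  calc ∮ ω in C(0, ε), f ω / ω ^ (n + 1) = ∮ ω in C(0, ε), (ω ^ (n + 1))⁻¹ * f ω := by
        simp only [div_eq_mul_inv, mul_comm]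
    _ = _ := by rw [h]; ring

/-- Termwise integration over a circle of a series dominated by a summable sequence of constants. -/
theorem circleIntegrable_and_hasSum_circleIntegral {ε : ℝ} (hε : 0 < ε) {g : ℕ → ℂ → ℂ} {u : ℕ → ℝ}
    {G : ℂ → ℂ} {s : Set ℂ} (hs : s.Countable)
    (hg : ∀ n, ContinuousOn (g n) (Metric.sphere 0 ε)) (hu : Summable u)
    (hgu : ∀ n, ∀ ω ∈ Metric.sphere (0 : ℂ) ε, ‖g n ω‖ ≤ u n)
    (hG : ∀ ω ∈ Metric.sphere (0 : ℂ) ε \ s, HasSum (fun n => g n ω) (G ω)) :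
    CircleIntegrable G 0 ε ∧
      HasSum (fun n => ∮ ω in C(0, ε), g n ω) (∮ ω in C(0, ε), G ω) := by
  have hmem : ∀ t, circleMap 0 ε t ∈ Metric.sphere (0 : ℂ) ε := circleMap_mem_sphere 0 hε.le
  have hnull : ∀ᵐ t : ℝ, circleMap 0 ε t ∉ s :=
    measure_eq_zero_iff_ae_notMem.mp ((hs.preimage_circleMap 0 hε.ne').measure_zero volume)
  -- The sum is continuous on the whole circle, whereas `G` need only agree with it almost
  -- everywhere.
  have hci : CircleIntegrable (fun ω => ∑' n, g n ω) 0 ε :=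
    (continuousOn_tsum hg hu hgu).circleIntegrable hε.le
  refine ⟨?_, ?_⟩
  · refine IntervalIntegrable.congr_ae hci (ae_restrict_of_ae ?_)
    filter_upwards [hnull] with t ht
    exact (hG _ ⟨hmem t, ht⟩).tsum_eq
  · have hcont : ∀ n, Continuous fun t => deriv (circleMap 0 ε) t • g n (circleMap 0 ε t) := by
      intro n
      have h1 := (hg n).comp_continuous (continuous_circleMap 0 ε) hmem
      simp only [deriv_circleMap]
      exact ((continuous_circleMap 0 ε).mul continuous_const).smul h1
    refine intervalIntegral.hasSum_integral_of_dominated_convergence (fun n _ => ε * u n)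
      (fun n => (hcont n).aestronglyMeasurable) (fun n => ae_of_all _ fun t _ => ?_)
      (ae_of_all _ fun t _ => hu.mul_left ε) intervalIntegrable_const ?_
    · rw [norm_smul, deriv_circleMap, norm_mul, norm_I, mul_one, norm_circleMap_zero,
        abs_of_pos hε]
      exact mul_le_mul_of_nonneg_left (hgu n _ (hmem t)) hε.le
    · filter_upwards [hnull] with t ht _
      exact (hG _ ⟨hmem t, ht⟩).const_smul _

theorem circleIntegrable_and_hasSum_qCauchyIntegral {q : ℝ} (hq : 1 < q) {r : ℝ} {f : ℂ → ℂ}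
    (hf : DifferentiableOn ℂ f (Metric.ball 0 r)) {ε : ℝ} (hε : 0 < ε) (hεr : ε < r) (k : ℕ)
    {z : ℂ} (hz : q ^ k * ‖z‖ < ε) {θ : ℂ → ℝ}
    (hθ : {ω ∈ Metric.sphere (0 : ℂ) ε | ¬ Admissible ω (θ ω)}.Countable) :
    CircleIntegrable (fun ω => f ω * rayIntegral (θ ω) (qKernel q k z ω)) 0 ε ∧
      HasSum (fun n : ℕ => (qFactorial q (n + k) / qFactorial q n : ℂ) *
        (iteratedDeriv (n + k) f 0 / ((n + k).factorial : ℂ)) * z ^ n)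
        (qCauchyIntegral q f ε k θ z) := by
  have hfc : ContinuousOn f (Metric.sphere 0 ε) := hf.continuousOn.mono
    (Metric.sphere_subset_closedBall.trans (Metric.closedBall_subset_ball hεr))
  obtain ⟨B, hB⟩ := (isCompact_sphere (0 : ℂ) ε).exists_bound_of_continuousOn hfc
  have hne : ∀ ω ∈ Metric.sphere (0 : ℂ) ε, ω ≠ 0 := fun ω hω =>
    norm_pos_iff.mp (by rw [mem_sphere_zero_iff_norm.mp hω]; exact hε)
  have hB0 : 0 ≤ B := (norm_nonneg _).trans (hB ε (by simp [abs_of_pos hε]))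
  have hL : (Real.log q : ℂ) ≠ 0 := mod_cast (Real.log_pos hq).ne'
  have hq1 : (q : ℂ) - 1 ≠ 0 := by
    rw [sub_ne_zero]; exact_mod_cast hq.ne'
  have hbound : ∀ n : ℕ, ∀ ω ∈ Metric.sphere (0 : ℂ) ε,
      ‖(Real.log q / (q - 1) * (qFactorial q (n + k) / qFactorial q n) * z ^ n : ℂ) *
        (f ω / ω ^ (n + k + 1))‖ ≤ B * ‖(Real.log q / (q - 1) : ℂ)‖ *
          (qFactorial q (n + k) / qFactorial q n * (‖z‖ ^ n / ε ^ (n + k + 1))) := by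
    intro n ω hω
    have hp := qFactorial_pos hq (n + k)
    have hp' := qFactorial_pos hq n
    rw [norm_mul, norm_mul, norm_mul, norm_div (f ω), norm_div (qFactorial q (n + k) : ℂ), norm_pow,
      norm_pow, mem_sphere_zero_iff_norm.mp hω, norm_real (qFactorial q (n + k)),
      norm_real (qFactorial q n), Real.norm_of_nonneg hp.le, Real.norm_of_nonneg hp'.le]
    have h1 := mul_le_mul_of_nonneg_right (hB ω hω) (show 0 ≤
      ‖(Real.log q / (q - 1) : ℂ)‖ * (qFactorial q (n + k) / qFactorial q n *
        (‖z‖ ^ n / ε ^ (n + k + 1))) by positivity)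
    refine (le_of_eq ?_).trans (h1.trans (le_of_eq ?_)) <;> ring
  have hlim : ∀ ω ∈ Metric.sphere (0 : ℂ) ε \ {ω ∈ Metric.sphere (0 : ℂ) ε | ¬ Admissible ω (θ ω)},
      HasSum (fun n : ℕ =>
        (Real.log q / (q - 1) * (qFactorial q (n + k) / qFactorial q n) * z ^ n : ℂ) *
          (f ω / ω ^ (n + k + 1))) (f ω * rayIntegral (θ ω) (qKernel q k z ω)) := by
    intro ω hω
    have hadm : Admissible ω (θ ω) := by
      by_contra hc
      exact hω.2 ⟨hω.1, hc⟩
    have h1 := (hasSum_rayIntegral_qKernel hq k (z := z) (ω := ω)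
      (by rwa [mem_sphere_zero_iff_norm.mp hω.1]) hadm).mul_left (f ω)
    refine h1.congr_fun fun n => ?_
    ring
  obtain ⟨hci, hsum⟩ := circleIntegrable_and_hasSum_circleIntegral hε
    (g := fun n ω => (Real.log q / (q - 1) * (qFactorial q (n + k) / qFactorial q n) * z ^ n) *
      (f ω / ω ^ (n + k + 1)))
    (G := fun ω => f ω * rayIntegral (θ ω) (qKernel q k z ω)) hθ
    (fun n => continuousOn_const.mul (hfc.div (by fun_prop) fun ω hω => pow_ne_zero _ (hne ω hω)))
    ((summable_qFactorial_ratio hq k (norm_nonneg z) hz).mul_left _) hbound hlim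
  refine ⟨hci, ?_⟩
  simp only [circleIntegral.integral_const_mul, circleIntegral_div_pow hf hε hεr] at hsum
  -- The prefactor cancels log q / (q-1) from the moments and 2πi from Cauchy's formula.
  refine HasSum.congr_fun (hsum.mul_left (((q - 1 : ℝ) : ℂ) / (2 * Real.pi * I * Real.log q)))
    fun n => ?_
  have hpi : (Real.pi : ℂ) ≠ 0 := mod_cast Real.pi_ne_zero
  have hI := I_ne_zero
  push_cast
  field_simp

/-! ### Power series of the iterated derivatives -/

theorem coeff_iterate_momentDeriv_qFactorial {q : ℝ} (hq : 1 < q) (a : PowerSeries ℂ) (k n : ℕ) :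
    PowerSeries.coeff n ((momentDeriv (qFactorial q))^[k] a) =
      (qFactorial q (n + k) / qFactorial q n : ℂ) * PowerSeries.coeff (n + k) a := by
  have h0 : ∀ m, (qFactorial q m : ℂ) ≠ 0 := fun m => mod_cast (qFactorial_pos hq m).ne'
  induction k generalizing n with
  | zero => simp [h0 n]
  | succ k ih =>
    rw [Function.iterate_succ_apply', momentDeriv, PowerSeries.coeff_mk, ih,
      show n + 1 + k = n + (k + 1) by ring]
    have := h0 n
    have := h0 (n + 1)
    push_cast
    field_simp

theorem hasSum_jacksonDeriv {q : ℝ} (hq : 1 < q) {R : ℝ} {g : ℂ → ℂ} {a : PowerSeries ℂ}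
    (hg : ∀ z : ℂ, ‖z‖ < R → HasSum (fun n : ℕ => PowerSeries.coeff n a * z ^ n) (g z))
    {z : ℂ} (hz : q * ‖z‖ < R) :
    HasSum (fun n : ℕ => PowerSeries.coeff n (momentDeriv (qFactorial q) a) * z ^ n)
      (jacksonDeriv q g z) := by
  have hq0 : 0 < q := one_pos.trans hq
  have hq1 : (q : ℂ) - 1 ≠ 0 := by
    rw [sub_ne_zero]; exact_mod_cast hq.ne'
  have hco : ∀ n, PowerSeries.coeff n (momentDeriv (qFactorial q) a) =
      qNumber q (n + 1) * PowerSeries.coeff (n + 1) a := by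
    intro n
    rw [momentDeriv, PowerSeries.coeff_mk, qFactorial_succ,
      mul_div_cancel_left₀ _ (qFactorial_pos hq n).ne']
  simp only [hco]
  by_cases hz0 : z = 0
  · subst hz0
    have hR : 0 < R := by simpa using hz
    -- At the origin only the linear coefficient survives, and [1]_q = 1.
    have hp : HasFPowerSeriesAt g (.ofScalars ℂ fun n => PowerSeries.coeff n a) 0 := by
      rw [hasFPowerSeriesAt_iff]
      filter_upwards [Metric.ball_mem_nhds (0 : ℂ) hR] with x hx
      simpa [mul_comm] using hg x (by simpa using hx)
    have hd := hp.deriv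
    rw [jacksonDeriv, if_pos rfl, hd]
    convert hasSum_single (f := fun n : ℕ =>
      (qNumber q (n + 1) : ℂ) * PowerSeries.coeff (n + 1) a * (0 : ℂ) ^ n) 0
      (fun n hn => by simp [hn]) using 1
    simp [qNumber, FormalMultilinearSeries.ofScalars]
  · rw [jacksonDeriv, if_neg hz0]
    have h1 := hg (q * z) (by simpa [abs_of_pos hq0] using hz)
    have h2 := hg z (lt_of_le_of_lt (le_mul_of_one_le_left (norm_nonneg z) hq.le) hz)
    have h3 := h1.sub h2
    rw [← hasSum_nat_add_iff' 1] at h3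
    simp only [Finset.range_one, Finset.sum_singleton, pow_zero, mul_one, sub_self, sub_zero] at h3
    refine HasSum.congr_fun (h3.div_const (q * z - z)) fun n => Eq.symm ?_
    have e : ((q : ℂ) - 1) * qNumber q (n + 1) = q ^ (n + 1) - 1 := by
      exact_mod_cast congrArg (fun x : ℝ => (x : ℂ)) (sub_one_mul_qNumber q (n + 1))
    have hne : (q : ℂ) * z - z ≠ 0 := by
      rw [← sub_one_mul]; exact mul_ne_zero hq1 hz0
    rw [div_eq_iff hne, mul_pow]
    linear_combination (-PowerSeries.coeff (n + 1) a * z ^ (n + 1)) * e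

theorem hasSum_iterate_jacksonDeriv {q : ℝ} (hq : 1 < q) {R : ℝ} {g : ℂ → ℂ} {a : PowerSeries ℂ}
    (hg : ∀ z : ℂ, ‖z‖ < R → HasSum (fun n : ℕ => PowerSeries.coeff n a * z ^ n) (g z))
    (k : ℕ) {z : ℂ} (hz : q ^ k * ‖z‖ < R) :
    HasSum (fun n : ℕ => PowerSeries.coeff n ((momentDeriv (qFactorial q))^[k] a) * z ^ n)
      ((jacksonDeriv q)^[k] g z) := by
  have hq0 : 0 < q := one_pos.trans hq
  induction k generalizing z with
  | zero => simpa using hg z (by simpa using hz)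
  | succ k ih =>
    rw [Function.iterate_succ_apply', Function.iterate_succ_apply']
    -- Each application samples the function at qz, so the disc shrinks by a factor q.
    refine hasSum_jacksonDeriv hq (R := R / q ^ k) (fun x hx => ih ?_) ?_
    · rwa [lt_div_iff₀' (pow_pos hq0 k)] at hx
    · rwa [lt_div_iff₀' (pow_pos hq0 k), ← mul_assoc, ← pow_succ]

theorem pqDeriv_one_left (q : ℝ) : pqDeriv 1 q = jacksonDeriv q := by
  funext f z
  simp only [pqDeriv, jacksonDeriv, ofReal_one, one_mul]
  rw [← neg_sub (f (q * z)), ← neg_sub (q * z), neg_div_neg_eq]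

theorem hasSum_maclaurin {r : ℝ} {f : ℂ → ℂ} (hf : DifferentiableOn ℂ f (Metric.ball 0 r)) {z : ℂ}
    (hz : ‖z‖ < r) : HasSum (fun n : ℕ => PowerSeries.coeff n (maclaurin f) * z ^ n) (f z) := by
  refine HasSum.congr_fun (hasSum_taylorSeries_on_ball hf (z := z) (by simpa using hz))
    fun n => Eq.symm ?_
  simp only [maclaurin, PowerSeries.coeff_mk, sub_zero, smul_eq_mul]
  ring

theorem theorem2 (q : ℝ) (hq : 1 < q) (r : ℝ) (f : ℂ → ℂ)
    (hf : DifferentiableOn ℂ f (Metric.ball 0 r))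
    (ε : ℝ) (hε : 0 < ε) (hεr : ε < r) (k : ℕ) (z : ℂ) (hz : ‖z‖ < (q ^ k)⁻¹ * ε) :
    -- the inner integral converges absolutely in every admissible direction
    (∀ ω ∈ Metric.sphere (0 : ℂ) ε, ∀ α : ℝ, Admissible ω α →
      RayIntegrable α (qKernel q k z ω)) ∧
    -- directions may depend on `ω`; a constant direction is inadmissible for exactly one `ω`
    ∀ θ : ℂ → ℝ, {ω ∈ Metric.sphere (0 : ℂ) ε | ¬ Admissible ω (θ ω)}.Countable →
      CircleIntegrable (fun ω => f ω * rayIntegral (θ ω) (qKernel q k z ω)) 0 ε ∧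
      (jacksonDeriv q)^[k] f z = qCauchyIntegral q f ε k θ z ∧
      (pqDeriv 1 q)^[k] f z = qCauchyIntegral q f ε k θ z ∧
      HasSum (fun n : ℕ =>
          PowerSeries.coeff n ((momentDeriv (qFactorial q))^[k] (maclaurin f)) * z ^ n)
        (qCauchyIntegral q f ε k θ z) := by
  have hz' : q ^ k * ‖z‖ < ε := (lt_inv_mul_iff₀ (pow_pos (one_pos.trans hq) k)).mp hz
  refine ⟨fun ω hω α hα => rayIntegrable_qKernel hq k
    (by rwa [mem_sphere_zero_iff_norm.mp hω]) hα, fun θ hθ => ?_⟩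
  obtain ⟨hci, hsum⟩ := circleIntegrable_and_hasSum_qCauchyIntegral hq hf hε hεr k hz' hθ
  have hmom : HasSum (fun n : ℕ =>
      PowerSeries.coeff n ((momentDeriv (qFactorial q))^[k] (maclaurin f)) * z ^ n)
      (qCauchyIntegral q f ε k θ z) := by
    simpa only [coeff_iterate_momentDeriv_qFactorial hq, maclaurin, PowerSeries.coeff_mk] using hsum
  have hjack := (hasSum_iterate_jacksonDeriv hq (fun x hx => hasSum_maclaurin hf hx) k
    (hz'.trans hεr)).unique hmom
  exact ⟨hci, hjack, by rw [pqDeriv_one_left]; exact hjack, hmom⟩
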